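/- For an integer $n\ge 1$ and $q\in\mathbb{R}$, let $\mathrm{MK}_n(q)$ denote the unweighted Minimum Knapsack problem: minimize $|x|:=\sum_{i=1}^n x_i$ subject to $|x|\ge q$ and $x\in\{0,1\}^n$. For an integer $d\ge 0$, the degree-$d$ sum-of-squares (SOS) program of $\mathrm{MK}_n(q)$ asks for the maximum of all $\lambda\in\mathbb{R}$ for which there are polynomials $s_0,s_1\in\mathbb{R}[x_1,\dots,x_n]$, each a sum of squares of polynomials, with $\deg s_0\le 2d+2$ and $\deg s_1\le 2d$, such that $$|x|-\lambda = s_0(x)+s_1(x)\,(|x|-q)\qquad\text{for all } x\in\{0,1\}^n .$$ The program is exact if this maximum is attained and equals the optimal value of $\mathrm{MK}_n(q)$ (which is $\lceil q\rceil$ for $0\le q\le n$), and the SOS rank of $\mathrm{MK}_n(q)$ is the smallest $d\ge 0$ for which the degree-$d$ SOS program is exact. Corollary. Let $q=q(n)$ be a sequence of real numbers such that, for all sufficiently large $n$, $0<q(n)<n$ and $q(n)$ is not an integer. If $q(n)=\Theta(n)$ and $n-q(n)=\Theta(n)$ as $n\to\infty$, then the SOS rank of $\mathrm{MK}_n(q(n))$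 is $\Theta(n)$ as $n\to\infty$. -/

import Mathlib

open Filter Asymptotics Matrix

/-- A linear optimization problem over the Boolean hypercube:
minimize `c ⬝ᵥ x` subject to `A *ᵥ x ≥ b` and `x ∈ {0,1}ⁿ`. -/
structure BooleanLP (n m : ℕ) where
  /-- the cost vector -/
  c : Fin n → ℝ
  /-- the constraint matrix -/
  A : Matrix (Fin m) (Fin n) ℝ
  /-- the right-hand side -/
  b : Fin m → ℝ

/-- The Boolean hypercube `{0,1}ⁿ` as a set of real vectors. -/
def booleanCube (n : ℕ) : Set (Fin n → ℝ) :=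
  {x | ∀ i, x i = 0 ∨ x i = 1}

namespace BooleanLP

variable {n m : ℕ}

/-- The feasible 0/1 points. -/
def feasible (P : BooleanLP n m) : Set (Fin n → ℝ) :=
  {x | x ∈ booleanCube n ∧ ∀ j, P.b j ≤ (P.A *ᵥ x) j}

/-- `v` is the optimal value of `P`: the minimum of the objective over the feasible points. -/
def IsOptimalValue (P : BooleanLP n m) (v : ℝ) : Prop :=
  IsLeast ((fun x => P.c ⬝ᵥ x) '' P.feasible) v

/-- The feasible values `l` of the degree-`d` sum-of-squares program of `P`: there are sums of
squares of polynomials `s₀` and `s j`, with `deg s₀ ≤ 2d + 2` and `deg (s j) ≤ 2d`, such that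
`cᵀx - l = s₀(x) + ∑ⱼ sⱼ(x) (A x - b)ⱼ` at all points of the hypercube. -/
def sosBounds (P : BooleanLP n m) (d : ℕ) : Set ℝ :=
  {l | ∃ (s₀ : MvPolynomial (Fin n) ℝ) (s : Fin m → MvPolynomial (Fin n) ℝ),
    IsSumSq s₀ ∧ (∀ j, IsSumSq (s j)) ∧
    s₀.totalDegree ≤ 2 * d + 2 ∧ (∀ j, (s j).totalDegree ≤ 2 * d) ∧
    ∀ x ∈ booleanCube n,
      P.c ⬝ᵥ x - l =
        MvPolynomial.eval x s₀ + ∑ j, MvPolynomial.eval x (s j) * ((P.A *ᵥ x) j - P.b j)}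

/-- The degree-`d` sum-of-squares program is exact: its maximum is the optimal value of `P`. -/
def SOSExact (P : BooleanLP n m) (d : ℕ) : Prop :=
  ∃ v, P.IsOptimalValue v ∧ IsGreatest (P.sosBounds d) v

/-- The SOS rank: the least `d` for which the degree-`d` sum-of-squares program is exact.
(A positive value of this infimum is always attained.) -/
noncomputable def sosRank (P : BooleanLP n m) : ℕ :=
  sInf {d | P.SOSExact d}

end BooleanLP

/-- The Minimum Knapsack problem: minimize `c ⬝ᵥ x` subject to `w ⬝ᵥ x ≥ q`, `x ∈ {0,1}ⁿ`. -/
def minKnapsack {n : ℕ} (c w : Fin n → ℝ) (q : ℝ) : BooleanLP n 1 where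
  c := c
  A := Matrix.of fun _ => w
  b := fun _ => q

/-- The unweighted Minimum Knapsack problem `MK(q)` in `n` variables: all costs and weights
are `1`. -/
def unweightedMK (n : ℕ) (q : ℝ) : BooleanLP n 1 :=
  minKnapsack (fun _ => 1) (fun _ => 1) q

/-! Put k = ⌈q⌉ and suppose the degree-d program attains k. On the level |x| = k the identity reads
0 = s₀ + s₁(k - q), and k > q because q is not an integer, so s₀ and s₁ both vanish there, and so
does every polynomial squared in them. Leading terms of squares cannot cancel, so these polynomials
have degree at most d + 1. If d + 1 ≤ min(k, n - k), Gottlieb's theorem makes each of them a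
multiple of |x| - k on the cube (`exists_eq_mul_of_vanish_on_level`), hence s₀ and s₁ are multiples
of (|x| - k)².

Averaging over levels (`exists_polynomial_sum_level`) gives X - k = (X - k)²(P₀ + P₁(X - q)) at X =
0, …, n. If 2d + 5 ≤ n this is a polynomial identity, which is absurd: k is a simple root on the
left. So the rank is at least linear. It is at most n, since degree n suffices to interpolate any
function on the cube. -/

/-! ### Leading terms and degrees in sums of squares. -/

namespace MonomialOrder

variable {σ : Type*} (m : MonomialOrder σ)

/-- No cancellation occurs in a sum of polynomials with nonnegative leading coefficients. -/
theorem degree_le_add_and_leadingCoeff_add_nonneg {f g : MvPolynomial σ ℝ}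
    (hf : 0 ≤ m.leadingCoeff f) (hg : 0 ≤ m.leadingCoeff g) :
    m.degree f ≼[m] m.degree (f + g) ∧ m.degree g ≼[m] m.degree (f + g) ∧
      0 ≤ m.leadingCoeff (f + g) := by
  rcases lt_trichotomy (m.toSyn (m.degree g)) (m.toSyn (m.degree f)) with h | h | h
  · rw [m.degree_add_of_lt h, m.leadingCoeff_add_of_lt h]
    exact ⟨le_rfl, h.le, hf⟩
  · have h' : m.degree g = m.degree f := m.toSyn.injective h
    rcases hf.eq_or_lt with h0 | h0
    · have : f = 0 := m.leadingCoeff_eq_zero_iff.1 h0.symm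
      subst this
      rw [zero_add]
      exact ⟨h.ge, le_rfl, hg⟩
    · have hc : (f + g).coeff (m.degree f) = m.leadingCoeff f + m.leadingCoeff g := by
        rw [MvPolynomial.coeff_add, leadingCoeff, leadingCoeff, h']
      have hpos : 0 < (f + g).coeff (m.degree f) := by rw [hc]; linarith
      have hle : m.degree f ≼[m] m.degree (f + g) :=
        m.le_degree (MvPolynomial.mem_support_iff.2 hpos.ne')
      have hge : m.degree (f + g) ≼[m] m.degree f :=
        m.degree_add_le.trans (by rw [h, sup_idem])
      have heq : m.degree (f + g) = m.degree f := m.toSyn.injective (le_antisymm hge hle)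
      refine ⟨hle, h' ▸ hle, ?_⟩
      rw [leadingCoeff, heq]
      exact hpos.le
  · rw [add_comm, m.degree_add_of_lt h, m.leadingCoeff_add_of_lt h]
    exact ⟨h.le, le_rfl, hg⟩

theorem leadingCoeff_nonneg_of_isSumSq {s : MvPolynomial σ ℝ} (hs : IsSumSq s) :
    0 ≤ m.leadingCoeff s := by
  induction hs with
  | zero => simp
  | sq_add a hs ih =>
    refine (m.degree_le_add_and_leadingCoeff_add_nonneg ?_ ih).2.2
    rw [leadingCoeff_mul]
    exact mul_self_nonneg _

end MonomialOrder

namespace MvPolynomial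

/-- All leading coefficients are nonnegative, so no summand's leading term cancels. The graded order
`degLex` turns this into a bound on total degrees. -/
theorem totalDegree_le_of_isSumSq_sq_add {n t : ℕ} {a s : MvPolynomial (Fin n) ℝ}
    (hs : IsSumSq s) (h : (a * a + s).totalDegree ≤ 2 * t) :
    a.totalDegree ≤ t ∧ s.totalDegree ≤ 2 * t := by
  have ha : 0 ≤ MonomialOrder.degLex.leadingCoeff (a * a) := by
    rw [MonomialOrder.leadingCoeff_mul]
    exact mul_self_nonneg _
  obtain ⟨h1, h2, -⟩ := MonomialOrder.degLex.degree_le_add_and_leadingCoeff_add_nonneg ha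
    (MonomialOrder.leadingCoeff_nonneg_of_isSumSq _ hs)
  refine ⟨?_, (MvPolynomial.degLex_totalDegree_monotone h2).trans h⟩
  rcases eq_or_ne a 0 with rfl | h0
  · simp
  · have := (MvPolynomial.degLex_totalDegree_monotone h1).trans h
    rw [totalDegree_mul_of_isDomain h0 h0] at this
    omega

theorem eval_nonneg_of_isSumSq {σ : Type*} {s : MvPolynomial σ ℝ} (hs : IsSumSq s) (x : σ → ℝ) :
    0 ≤ eval x s := by
  induction hs with
  | zero => simp
  | sq_add a hs ih =>
    rw [map_add, map_mul]
    exact add_nonneg (mul_self_nonneg _) ih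

end MvPolynomial

/-! ### Low-degree functions on the Boolean cube and its levels. -/

section SetFunctions

variable {α : Type*} [DecidableEq α]

/-- Gottlieb's theorem: the inclusion matrix between the `t`-subsets and the `k`-subsets of a set
with at least `k + t` elements has trivial kernel if `t ≤ k`. -/
theorem eq_zero_of_sum_powersetCard_eq_zero (t : ℕ) : ∀ (U : Finset α) (k : ℕ), t ≤ k →
    k + t ≤ U.card → ∀ h : Finset α → ℝ,
    (∀ T ∈ U.powersetCard k, ∑ S ∈ T.powersetCard t, h S = 0) →
    ∀ S ∈ U.powersetCard t, h S = 0 := by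
  induction t with
  | zero =>
    intro U k _ hU h hh S hS
    obtain ⟨T, hT⟩ := Finset.powersetCard_nonempty.2 (show k ≤ U.card by omega)
    have := hh T hT
    simp_all
  | succ t ih =>
    intro U k htk hU h hh
    -- Swapping i for j leaves h unchanged: the difference satisfies the hypothesis for t and k - 1
    -- on U without i and j, since the part of the sum over T ∪ {l} that avoids l does not depend on
    -- l.
    have exch : ∀ i ∈ U, ∀ j ∈ U, i ≠ j → ∀ S ⊆ (U.erase i).erase j, S.card = t →
        h (insert i S) = h (insert j S) := by
      intro i hi j hj hij S hS hcard
      obtain ⟨k, rfl⟩ : ∃ l, k = l + 1 := ⟨k - 1, by omega⟩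
      have hc : ((U.erase i).erase j).card + 2 = U.card := by
        rw [Finset.card_erase_of_mem (by simp [hj, hij.symm]), Finset.card_erase_of_mem hi]
        omega
      refine sub_eq_zero.1 (ih ((U.erase i).erase j) k (by omega) (by omega)
        (fun S => h (insert i S) - h (insert j S)) ?_ S (by simp [hS, hcard]))
      intro T hT
      rw [Finset.mem_powersetCard] at hT
      have hiT : i ∉ T := fun hm => by simpa using hT.1 hm
      have hjT : j ∉ T := fun hm => by simpa using hT.1 hm
      have key : ∀ l ∈ U, l ∉ T → ∑ S ∈ T.powersetCard t, h (insert l S)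
          = - ∑ S ∈ T.powersetCard (t + 1), h S := by
        intro l hl hlT
        have h1 := hh (insert l T) (by
          rw [Finset.mem_powersetCard, Finset.card_insert_of_notMem hlT, hT.2]
          refine ⟨Finset.insert_subset hl (hT.1.trans ?_), rfl⟩
          exact (Finset.erase_subset _ _).trans (Finset.erase_subset _ _))
        rw [Finset.powersetCard_succ_insert hlT, Finset.sum_union, Finset.sum_image] at h1
        · linarith
        · intro A hA B hB hAB
          rw [Finset.mem_coe, Finset.mem_powersetCard] at hA hB
          rw [← Finset.erase_insert (fun hm => hlT (hA.1 hm)), hAB,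
            Finset.erase_insert (fun hm => hlT (hB.1 hm))]
        · rw [Finset.disjoint_left]
          intro A hA hA'
          obtain ⟨B, -, rfl⟩ := Finset.mem_image.1 hA'
          exact hlT ((Finset.mem_powersetCard.1 hA).1 (Finset.mem_insert_self _ _))
      rw [Finset.sum_sub_distrib, key i hi hiT, key j hj hjT, sub_self]
    -- Swaps connect any two (t+1)-subsets, so h is constant on them; each sum is then a nonzero
    -- binomial coefficient times that constant.
    have const : ∀ m : ℕ, ∀ A B : Finset α, A ⊆ U → B ⊆ U → A.card = t + 1 → B.card = t + 1 →
        (A \ B).card = m → h A = h B := by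
      intro m
      induction m with
      | zero =>
        intro A B _ _ hA hB hAB
        rw [Finset.card_eq_zero, Finset.sdiff_eq_empty_iff_subset] at hAB
        rw [Finset.eq_of_subset_of_card_le hAB (by omega)]
      | succ m ihm =>
        intro A B hAU hBU hA hB hAB
        obtain ⟨i, hi⟩ := Finset.card_pos.1 (show 0 < (A \ B).card by omega)
        have hBA : (B \ A).card = (A \ B).card := by
          have := Finset.card_sdiff_add_card_inter A B
          have := Finset.card_sdiff_add_card_inter B A
          rw [Finset.inter_comm] at this
          omega
        obtain ⟨j, hj⟩ := Finset.card_pos.1 (show 0 < (B \ A).card by omega)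
        rw [Finset.mem_sdiff] at hi hj
        have hij : i ≠ j := by rintro rfl; exact hj.2 hi.1
        have hcard : (A.erase i).card = t := by rw [Finset.card_erase_of_mem hi.1]; omega
        have hjA : j ∉ A.erase i := fun hm => hj.2 (Finset.mem_of_mem_erase hm)
        have h1 := exch i (hAU hi.1) j (hBU hj.1) hij (A.erase i) (by
          intro x hx
          have hxA := Finset.mem_erase.1 hx
          simp only [Finset.mem_erase]
          exact ⟨fun hxj => hjA (hxj ▸ hx), hxA.1, hAU hxA.2⟩) hcard
        rw [Finset.insert_erase hi.1] at h1
        rw [h1]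
        refine ihm _ _ ?_ hBU ?_ hB ?_
        · exact Finset.insert_subset (hBU hj.1) ((Finset.erase_subset _ _).trans hAU)
        · rw [Finset.card_insert_of_notMem hjA, hcard]
        · rw [Finset.insert_sdiff_of_mem _ hj.1, Finset.erase_sdiff_comm,
            Finset.card_erase_of_mem (Finset.mem_sdiff.2 hi)]
          omega
    intro S hS
    rw [Finset.mem_powersetCard] at hS
    obtain ⟨T, hT⟩ := Finset.powersetCard_nonempty.2 (show k ≤ U.card by omega)
    have hsum := hh T hT
    rw [Finset.mem_powersetCard] at hT
    rw [Finset.sum_congr rfl (g := fun _ => h S), Finset.sum_const, Finset.card_powersetCard, hT.2,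
      nsmul_eq_mul, mul_eq_zero, Nat.cast_eq_zero, Nat.choose_eq_zero_iff] at hsum
    · exact hsum.resolve_left (by omega)
    · intro A hA
      rw [Finset.mem_powersetCard] at hA
      exact const _ A S (hA.1.trans hT.1) hS.1 hA.2 hS.2 rfl

/-- The multilinear monomial with support `A`, as a function on the Boolean cube. -/
def cubeMonomial (A : Finset α) : Finset α → ℝ := fun T => if A ⊆ T then 1 else 0

variable (α) in
/-- The functions on the Boolean cube of degree at most `d`. -/
def cubeDegreeLE (d : ℕ) : Submodule ℝ (Finset α → ℝ) :=
  Submodule.span ℝ (cubeMonomial '' {A : Finset α | A.card ≤ d})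

theorem cubeMonomial_mem_cubeDegreeLE {A : Finset α} {d : ℕ} (h : A.card ≤ d) :
    cubeMonomial A ∈ cubeDegreeLE α d :=
  Submodule.subset_span ⟨A, h, rfl⟩

theorem cubeMonomial_mul (A B : Finset α) :
    cubeMonomial A * cubeMonomial B = cubeMonomial (A ∪ B) := by
  ext T
  simp only [cubeMonomial, Pi.mul_apply, Finset.union_subset_iff, ite_and]
  split_ifs <;> simp

theorem mul_mem_cubeDegreeLE {a b : ℕ} {f g : Finset α → ℝ} (hf : f ∈ cubeDegreeLE α a)
    (hg : g ∈ cubeDegreeLE α b) : f * g ∈ cubeDegreeLE α (a + b) := by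
  have h := Submodule.mul_mem_mul hf hg
  rw [cubeDegreeLE, cubeDegreeLE, Submodule.span_mul_span] at h
  refine Submodule.span_mono ?_ h
  rintro _ ⟨_, ⟨A, hA, rfl⟩, _, ⟨B, hB, rfl⟩, rfl⟩
  refine ⟨A ∪ B, ?_, (cubeMonomial_mul A B).symm⟩
  have := Finset.card_union_le A B
  simp only [Set.mem_ofPred_eq] at hA hB ⊢
  omega

variable [Fintype α]

/-- A set T containing A has |T| - |A| elements outside A. Modulo |x| - k this trades a monomial for
monomials of one degree more. -/
theorem sum_cubeMonomial_insert (A T : Finset α) :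
    ∑ i ∈ Aᶜ, cubeMonomial (insert i A) T = ((T.card : ℝ) - A.card) * cubeMonomial A T := by
  by_cases h : A ⊆ T
  · have : ∀ i, cubeMonomial (insert i A) T = if i ∈ T then 1 else 0 := by
      intro i
      simp [cubeMonomial, Finset.insert_subset_iff, h]
    have hA : cubeMonomial A T = 1 := if_pos h
    simp only [this, hA, Finset.sum_ite_mem, Finset.sum_const, nsmul_eq_mul, mul_one]
    rw [Finset.inter_comm, ← Finset.sdiff_eq_inter_compl, Finset.card_sdiff_of_subset h,
      Nat.cast_sub (Finset.card_le_card h)]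
  · simp [cubeMonomial, Finset.insert_subset_iff, h]

/-- Modulo the multiples of `|x| - k`, a function of degree at most `t ≤ k` is homogeneous of
degree `t`. -/
theorem exists_homogeneous_of_mem_cubeDegreeLE {t k : ℕ} (htk : t ≤ k) {f : Finset α → ℝ}
    (hf : f ∈ cubeDegreeLE α t) :
    ∃ r ∈ cubeDegreeLE α t, ∃ h : Finset α → ℝ, ∀ T,
      f T = ((T.card : ℝ) - k) * r T
        + ∑ A ∈ Finset.univ.powersetCard t, h A * cubeMonomial A T := by
  let Q : Submodule ℝ (Finset α → ℝ) :=
    { carrier := {f | ∃ r ∈ cubeDegreeLE α t, ∃ h : Finset α → ℝ, ∀ T,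
        f T = ((T.card : ℝ) - k) * r T
          + ∑ A ∈ Finset.univ.powersetCard t, h A * cubeMonomial A T}
      add_mem' := by
        rintro f g ⟨r, hr, h, hf⟩ ⟨r', hr', h', hg⟩
        refine ⟨r + r', add_mem hr hr', h + h', fun T => ?_⟩
        simp only [Pi.add_apply, hf, hg, add_mul, Finset.sum_add_distrib]
        ring
      zero_mem' := ⟨0, zero_mem _, 0, fun T => by simp⟩
      smul_mem' := by
        rintro c f ⟨r, hr, h, hf⟩
        refine ⟨c • r, Submodule.smul_mem _ _ hr, c • h, fun T => ?_⟩
        simp only [Pi.smul_apply, smul_eq_mul, hf, mul_add, Finset.mul_sum, mul_assoc]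
        ring }
  -- Induction on the missing degree m = t - |A|. Raising the degree divides by k - |A|, which is
  -- nonzero because |A| < t ≤ k.
  have hQ : ∀ m : ℕ, ∀ A : Finset α, A.card + m = t → cubeMonomial A ∈ Q := by
    intro m
    induction m with
    | zero =>
      intro A hA
      refine ⟨0, zero_mem _, fun B => if B = A then 1 else 0, fun T => ?_⟩
      simp only [Pi.zero_apply, mul_zero, zero_add, ite_mul, one_mul, zero_mul,
        Finset.sum_ite_eq']
      rw [if_pos (by simpa using hA)]
    | succ m ih =>
      intro A hA
      have hne : (k : ℝ) - A.card ≠ 0 := by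
        have : (A.card : ℝ) < k := by exact_mod_cast (show A.card < k by omega)
        linarith
      have hins : ∑ i ∈ Aᶜ, cubeMonomial (insert i A) ∈ Q := by
        refine Submodule.sum_mem _ fun i hi => ih _ ?_
        rw [Finset.card_insert_of_notMem (Finset.mem_compl.1 hi)]
        omega
      have hmul : (fun T : Finset α => ((T.card : ℝ) - k) * cubeMonomial A T) ∈ Q :=
        ⟨cubeMonomial A, cubeMonomial_mem_cubeDegreeLE (by omega), 0, fun T => by simp⟩
      have heq : cubeMonomial A = ((k : ℝ) - A.card)⁻¹ • (∑ i ∈ Aᶜ, cubeMonomial (insert i A)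
          - fun T : Finset α => ((T.card : ℝ) - k) * cubeMonomial A T) := by
        ext T
        simp only [Pi.smul_apply, Pi.sub_apply, Finset.sum_apply, sum_cubeMonomial_insert,
          smul_eq_mul]
        field_simp
        ring
      rw [heq]
      exact Submodule.smul_mem _ _ (sub_mem hins hmul)
  have hle : cubeDegreeLE α t ≤ Q := by
    rw [cubeDegreeLE, Submodule.span_le]
    rintro _ ⟨A, hA, rfl⟩
    exact hQ (t - A.card) A (Nat.add_sub_cancel' hA)
  exact hle hf

/-- A function of degree at most `t ≤ min k (n - k)` that vanishes on the `k`-th level of the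
Boolean cube is a multiple of `|x| - k`. -/
theorem exists_eq_mul_of_vanish_on_level {t k : ℕ} (htk : t ≤ k) (hk : k + t ≤ Fintype.card α)
    {f : Finset α → ℝ} (hf : f ∈ cubeDegreeLE α t) (h0 : ∀ T : Finset α, T.card = k → f T = 0) :
    ∃ r ∈ cubeDegreeLE α t, ∀ T, f T = ((T.card : ℝ) - k) * r T := by
  obtain ⟨r, hr, h, hfr⟩ := exists_homogeneous_of_mem_cubeDegreeLE htk hf
  refine ⟨r, hr, fun T => ?_⟩
  have hz := eq_zero_of_sum_powersetCard_eq_zero t Finset.univ k htk hk h (by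
    intro T hT
    rw [Finset.mem_powersetCard] at hT
    have h1 := hfr T
    rw [h0 T hT.2, hT.2, sub_self, zero_mul, zero_add] at h1
    rw [h1]
    refine Finset.sum_subset_zero_on_sdiff (Finset.powersetCard_mono (Finset.subset_univ T)) ?_ ?_
    · intro A hA
      simp only [Finset.mem_sdiff, Finset.mem_powersetCard, Finset.subset_univ, true_and,
        not_and'] at hA
      simp [cubeMonomial, hA.2 hA.1]
    · intro A hA
      simp [cubeMonomial, (Finset.mem_powersetCard.1 hA).1])
  rw [hfr T, Finset.sum_eq_zero, add_zero]
  intro A hA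
  rw [hz A hA, zero_mul]

/-- The average of a degree-`d` function over the levels of the Boolean cube is a polynomial of
degree at most `d` in the level. -/
theorem exists_polynomial_sum_level {d : ℕ} {f : Finset α → ℝ} (hf : f ∈ cubeDegreeLE α d) :
    ∃ P : Polynomial ℝ, P.natDegree ≤ d ∧ ∀ j ≤ Fintype.card α,
      ∑ T ∈ Finset.univ.powersetCard j, f T = (Fintype.card α).choose j * P.eval (j : ℝ) := by
  induction hf using Submodule.span_induction with
  | mem f hf =>
    obtain ⟨A, hA, rfl⟩ := hf
    have hAn : A.card ≤ Fintype.card α := Finset.card_le_univ A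
    have hpos : ((Fintype.card α).choose A.card : ℝ) ≠ 0 := by
      exact_mod_cast (Nat.choose_pos hAn).ne'
    -- The proportion of j-sets containing A is C(j,|A|) / C(n,|A|), a polynomial in j of degree
    -- |A|.
    refine ⟨Polynomial.C (((Fintype.card α).choose A.card : ℝ)⁻¹ * ((A.card.factorial : ℝ))⁻¹)
      * descPochhammer ℝ A.card, ?_, ?_⟩
    · exact (Polynomial.natDegree_C_mul_le _ _).trans ((descPochhammer_natDegree ℝ _).trans_le hA)
    · intro j hj
      have hsum : ∑ T ∈ Finset.univ.powersetCard j, cubeMonomial A T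
          = (((Finset.univ.powersetCard j).filter (A ⊆ ·)).card : ℝ) := by
        simp [cubeMonomial]
      have hch : ((j.choose A.card : ℕ) : ℝ)
          = (descPochhammer ℝ A.card).eval (j : ℝ) / A.card.factorial :=
        Nat.cast_choose_eq_descPochhammer_div ℝ j A.card
      have hcount : ((Finset.univ.powersetCard j).filter (A ⊆ ·)).card
          * (Fintype.card α).choose A.card = (Fintype.card α).choose j * j.choose A.card := by
        rcases le_or_gt A.card j with h | h
        · rw [Finset.card_filter_powersetCard_subset _ _ _ (Finset.subset_univ A) h,
            Nat.choose_mul h, mul_comm, Finset.card_univ]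
        · rw [Nat.choose_eq_zero_of_lt h, Finset.card_eq_zero.2, zero_mul, mul_zero]
          refine Finset.filter_eq_empty_iff.2 fun T hT hAT => ?_
          have := Finset.card_le_card hAT
          rw [(Finset.mem_powersetCard.1 hT).2] at this
          omega
      have hcount' : (((Finset.univ.powersetCard j).filter (A ⊆ ·)).card : ℝ)
          * (Fintype.card α).choose A.card = (Fintype.card α).choose j * j.choose A.card := by
        exact_mod_cast hcount
      rw [hsum, Polynomial.eval_mul, Polynomial.eval_C, eq_div_of_mul_eq hpos hcount', hch]
      ring
  | zero => exact ⟨0, by simp, by simp⟩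
  | add f g _ _ hf hg =>
    obtain ⟨P, hP, hfP⟩ := hf
    obtain ⟨R, hR, hgR⟩ := hg
    refine ⟨P + R, Polynomial.natDegree_add_le_of_degree_le hP hR, fun j hj => ?_⟩
    simp only [Pi.add_apply, Finset.sum_add_distrib, hfP j hj, hgR j hj, Polynomial.eval_add]
    ring
  | smul c f _ hf =>
    obtain ⟨P, hP, hfP⟩ := hf
    refine ⟨Polynomial.C c * P, (Polynomial.natDegree_C_mul_le _ _).trans hP, fun j hj => ?_⟩
    simp only [Pi.smul_apply, smul_eq_mul, ← Finset.mul_sum, hfP j hj, Polynomial.eval_mul,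
      Polynomial.eval_C]
    ring

end SetFunctions

/-! ### From polynomials to functions on the cube, and interpolation. -/

section CubePoints

variable {n : ℕ}

/-- The indicator vector of a subset of the coordinates. -/
def cubePoint (T : Finset (Fin n)) : Fin n → ℝ := fun i => if i ∈ T then 1 else 0

theorem cubePoint_mem_booleanCube (T : Finset (Fin n)) : cubePoint T ∈ booleanCube n := by
  intro i
  by_cases h : i ∈ T <;> simp [cubePoint, h]

theorem exists_cubePoint_eq {x : Fin n → ℝ} (hx : x ∈ booleanCube n) :
    ∃ T : Finset (Fin n), cubePoint T = x := by
  refine ⟨Finset.univ.filter fun i => x i = 1, ?_⟩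
  ext i
  rcases hx i with h | h <;> simp [cubePoint, h]

theorem sum_cubePoint (T : Finset (Fin n)) : ∑ i, cubePoint T i = T.card := by
  simp [cubePoint]

theorem eval_monomial_cubePoint (s : Fin n →₀ ℕ) (c : ℝ) (T : Finset (Fin n)) :
    MvPolynomial.eval (cubePoint T) (MvPolynomial.monomial s c) = c * cubeMonomial s.support T := by
  rw [MvPolynomial.eval_monomial]
  congr 1
  by_cases h : s.support ⊆ T
  · rw [cubeMonomial, if_pos h]
    exact Finset.prod_eq_one fun i hi => by simp [cubePoint, h hi]
  · rw [cubeMonomial, if_neg h]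
    obtain ⟨i, hi, hiT⟩ := Finset.not_subset.1 h
    exact Finset.prod_eq_zero hi (by
      simp only [cubePoint, if_neg hiT]
      exact zero_pow (Finsupp.mem_support_iff.1 hi))

theorem eval_cubePoint_mem_cubeDegreeLE {d : ℕ} {p : MvPolynomial (Fin n) ℝ}
    (hp : p.totalDegree ≤ d) :
    (fun T => MvPolynomial.eval (cubePoint T) p) ∈ cubeDegreeLE (Fin n) d := by
  have : (fun T => MvPolynomial.eval (cubePoint T) p)
      = ∑ s ∈ p.support, p.coeff s • cubeMonomial s.support := by
    ext T
    conv_lhs => rw [p.as_sum]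
    simp only [map_sum, eval_monomial_cubePoint, Finset.sum_apply, Pi.smul_apply, smul_eq_mul]
  rw [this]
  refine Submodule.sum_mem _ fun s hs =>
    Submodule.smul_mem _ _ (cubeMonomial_mem_cubeDegreeLE ?_)
  refine le_trans ?_ ((MvPolynomial.le_totalDegree hs).trans hp)
  rw [Finsupp.sum, Finset.card_eq_sum_ones]
  exact Finset.sum_le_sum fun i hi => Nat.one_le_iff_ne_zero.2 (Finsupp.mem_support_iff.1 hi)

/-- A sum of squares of degree at most `2t` that vanishes on the `k`-th level is a multiple of
`(|x| - k)²` on the cube. -/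
theorem exists_eq_sq_mul_of_isSumSq {t k : ℕ} (htk : t ≤ k) (hk : k + t ≤ n)
    {s : MvPolynomial (Fin n) ℝ} (hs : IsSumSq s) (hdeg : s.totalDegree ≤ 2 * t)
    (h0 : ∀ T : Finset (Fin n), T.card = k → MvPolynomial.eval (cubePoint T) s = 0) :
    ∃ R ∈ cubeDegreeLE (Fin n) (2 * t), ∀ T : Finset (Fin n),
      MvPolynomial.eval (cubePoint T) s = ((T.card : ℝ) - k) ^ 2 * R T := by
  induction hs with
  | zero => exact ⟨0, zero_mem _, fun T => by simp⟩
  | @sq_add a s hs ih =>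
    obtain ⟨ha, hs'⟩ := MvPolynomial.totalDegree_le_of_isSumSq_sq_add hs hdeg
    have hz : ∀ T : Finset (Fin n), T.card = k → MvPolynomial.eval (cubePoint T) a = 0 ∧
        MvPolynomial.eval (cubePoint T) s = 0 := by
      intro T hT
      have h1 := h0 T hT
      have h2 := MvPolynomial.eval_nonneg_of_isSumSq hs (cubePoint T)
      rw [map_add, map_mul] at h1
      have h3 := mul_self_nonneg (MvPolynomial.eval (cubePoint T) a)
      exact ⟨mul_self_eq_zero.1 (by linarith), by linarith⟩
    obtain ⟨R, hR, hRs⟩ := ih hs' fun T hT => (hz T hT).2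
    obtain ⟨r, hr, hra⟩ := exists_eq_mul_of_vanish_on_level htk (by simpa using hk)
      (eval_cubePoint_mem_cubeDegreeLE ha) fun T hT => (hz T hT).1
    refine ⟨r * r + R, add_mem ?_ hR, fun T => ?_⟩
    · rw [two_mul]
      exact mul_mem_cubeDegreeLE hr hr
    · rw [map_add, map_mul, hRs, hra, Pi.add_apply, Pi.mul_apply]
      ring

/-- Every function on the cube is given by a polynomial of degree at most `n`. -/
theorem exists_polynomial_eval_cubePoint (f : Finset (Fin n) → ℝ) :
    ∃ p : MvPolynomial (Fin n) ℝ, p.totalDegree ≤ n ∧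
      ∀ T, MvPolynomial.eval (cubePoint T) p = f T := by
  -- On the cube, the product of `F S i` over i is the indicator of the point S.
  let F : Finset (Fin n) → Fin n → MvPolynomial (Fin n) ℝ := fun S i =>
    if i ∈ S then MvPolynomial.X i else 1 - MvPolynomial.X i
  have hF : ∀ S i, (F S i).totalDegree ≤ 1 := by
    intro S i
    simp only [F]
    split_ifs
    · exact (MvPolynomial.totalDegree_X i).le
    · refine (MvPolynomial.totalDegree_sub _ _).trans ?_
      simp
  refine ⟨∑ S, MvPolynomial.C (f S) * ∏ i, F S i, ?_, fun T => ?_⟩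
  · refine MvPolynomial.totalDegree_finsetSum_le fun S _ => ?_
    refine (MvPolynomial.totalDegree_mul _ _).trans ?_
    rw [MvPolynomial.totalDegree_C, zero_add]
    refine (MvPolynomial.totalDegree_finsetProd _ _).trans ?_
    exact (Finset.sum_le_sum fun i _ => hF S i).trans (by simp)
  · have hev : ∀ S, ∏ i, MvPolynomial.eval (cubePoint T) (F S i) = if S = T then 1 else 0 := by
      intro S
      split_ifs with h
      · subst h
        refine Finset.prod_eq_one fun i _ => ?_
        by_cases hi : i ∈ S <;> simp [F, cubePoint, hi]
      · obtain ⟨i, hi⟩ : ∃ i, ¬ (i ∈ S ↔ i ∈ T) := by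
          by_contra! hc
          exact h (Finset.ext hc)
        refine Finset.prod_eq_zero (Finset.mem_univ i) ?_
        by_cases hS : i ∈ S <;> by_cases hT : i ∈ T <;> simp_all [F, cubePoint]
    simp [map_sum, map_mul, map_prod, hev]

/-- A nonnegative function on the cube is a sum of squares of degree at most `2n`. -/
theorem exists_isSumSq_eval_cubePoint {f : Finset (Fin n) → ℝ} (hf : ∀ T, 0 ≤ f T) :
    ∃ s : MvPolynomial (Fin n) ℝ, IsSumSq s ∧ s.totalDegree ≤ 2 * n ∧
      ∀ T, MvPolynomial.eval (cubePoint T) s = f T := by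
  obtain ⟨p, hp, hpf⟩ := exists_polynomial_eval_cubePoint fun T => √(f T)
  refine ⟨p * p, IsSumSq.mul_self p, (MvPolynomial.totalDegree_mul _ _).trans (by omega), ?_⟩
  intro T
  rw [map_mul, hpf, Real.mul_self_sqrt (hf T)]

end CubePoints

/-! ### Bounds on the rank of the unweighted knapsack. -/

section UnweightedKnapsack

variable {n : ℕ} {q : ℝ}

theorem unweightedMK_cost_cubePoint (T : Finset (Fin n)) :
    (unweightedMK n q).c ⬝ᵥ cubePoint T = T.card := by
  rw [← sum_cubePoint]
  simp [unweightedMK, minKnapsack, dotProduct]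

theorem unweightedMK_weight_cubePoint (T : Finset (Fin n)) (j : Fin 1) :
    ((unweightedMK n q).A *ᵥ cubePoint T) j = T.card := by
  rw [← sum_cubePoint]
  simp [unweightedMK, minKnapsack, dotProduct, mulVec]

theorem unweightedMK_isOptimalValue (hqn : q ≤ n) :
    (unweightedMK n q).IsOptimalValue ⌈q⌉₊ := by
  constructor
  · obtain ⟨T, -, hT⟩ := Finset.exists_subset_card_eq
      (show ⌈q⌉₊ ≤ (Finset.univ : Finset (Fin n)).card by simpa using hqn)
    refine ⟨cubePoint T, ⟨cubePoint_mem_booleanCube T, fun j => ?_⟩, ?_⟩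
    · rw [unweightedMK_weight_cubePoint, hT]
      exact Nat.le_ceil q
    · simp only [unweightedMK_cost_cubePoint, hT]
  · rintro _ ⟨x, ⟨hx, hxq⟩, rfl⟩
    obtain ⟨T, rfl⟩ := exists_cubePoint_eq hx
    have h := hxq 0
    rw [unweightedMK_weight_cubePoint] at h
    simp only [unweightedMK_cost_cubePoint]
    exact_mod_cast Nat.ceil_le.2 h

theorem unweightedMK_mem_sosBounds_iff {d : ℕ} {l : ℝ} :
    l ∈ (unweightedMK n q).sosBounds d ↔ ∃ s₀ s₁ : MvPolynomial (Fin n) ℝ,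
      IsSumSq s₀ ∧ IsSumSq s₁ ∧ s₀.totalDegree ≤ 2 * d + 2 ∧ s₁.totalDegree ≤ 2 * d ∧
      ∀ T : Finset (Fin n), (T.card : ℝ) - l = MvPolynomial.eval (cubePoint T) s₀ +
        MvPolynomial.eval (cubePoint T) s₁ * ((T.card : ℝ) - q) := by
  have hb : (unweightedMK n q).b 0 = q := rfl
  constructor
  · rintro ⟨s₀, s, h₀, hs, hd₀, hds, h⟩
    refine ⟨s₀, s 0, h₀, hs 0, hd₀, hds 0, fun T => ?_⟩
    have := h _ (cubePoint_mem_booleanCube T)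
    rwa [unweightedMK_cost_cubePoint, Fin.sum_univ_one, unweightedMK_weight_cubePoint, hb] at this
  · rintro ⟨s₀, s₁, h₀, hs, hd₀, hds, h⟩
    refine ⟨s₀, fun _ => s₁, h₀, fun _ => hs, hd₀, fun _ => hds, fun x hx => ?_⟩
    obtain ⟨T, rfl⟩ := exists_cubePoint_eq hx
    rw [unweightedMK_cost_cubePoint, Fin.sum_univ_one, unweightedMK_weight_cubePoint, hb]
    exact h T

/-- The degree-`n` sum-of-squares program of the unweighted knapsack problem is exact. -/
theorem unweightedMK_sosExact (hqn : q ≤ n) : (unweightedMK n q).SOSExact n := by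
  refine ⟨_, unweightedMK_isOptimalValue hqn, ?_, ?_⟩
  -- Feasible points are handled by s₀ alone, infeasible ones by s₁ alone.
  · obtain ⟨s₀, h₀, hd₀, he₀⟩ := exists_isSumSq_eval_cubePoint (n := n)
      (f := fun T => if q ≤ T.card then (T.card : ℝ) - ⌈q⌉₊ else 0) (fun T => by
        split_ifs with h
        · have : (⌈q⌉₊ : ℝ) ≤ T.card := by exact_mod_cast Nat.ceil_le.2 h
          linarith
        · rfl)
    obtain ⟨s₁, h₁, hd₁, he₁⟩ := exists_isSumSq_eval_cubePoint (n := n)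
      (f := fun T => if q ≤ T.card then 0 else (⌈q⌉₊ - (T.card : ℝ)) / (q - T.card)) (fun T => by
        split_ifs with h
        · rfl
        · push Not at h
          exact div_nonneg (by linarith [Nat.le_ceil q]) (by linarith))
    refine unweightedMK_mem_sosBounds_iff.2
      ⟨s₀, s₁, h₀, h₁, by omega, hd₁, fun T => ?_⟩
    rw [he₀, he₁]
    split_ifs with h
    · ring
    · have : q - T.card ≠ 0 := by
        push Not at h
        linarith
      field_simp
      ring
  · intro l hl
    obtain ⟨s₀, s₁, h₀, h₁, -, -, h⟩ := unweightedMK_mem_sosBounds_iff.1 hl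
    obtain ⟨T, -, hT⟩ := Finset.exists_subset_card_eq
      (show ⌈q⌉₊ ≤ (Finset.univ : Finset (Fin n)).card by simpa using hqn)
    have hl' := h T
    have hs₀ := MvPolynomial.eval_nonneg_of_isSumSq h₀ (cubePoint T)
    have hs₁ := mul_nonneg (MvPolynomial.eval_nonneg_of_isSumSq h₁ (cubePoint T))
      (sub_nonneg.2 (Nat.le_ceil q))
    rw [hT] at hl'
    linarith

/-- Low-degree sum-of-squares programs of the unweighted knapsack problem with nonintegral `q`
are not exact. -/
theorem unweightedMK_not_sosExact (hqn : q ≤ n) (hq : q < ⌈q⌉₊) {d : ℕ} (hdk : d + 1 ≤ ⌈q⌉₊)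
    (hkn : ⌈q⌉₊ + (d + 1) ≤ n) (hdn : 2 * d + 5 ≤ n) : ¬ (unweightedMK n q).SOSExact d := by
  rintro ⟨v, hv, hv', -⟩
  rw [hv.unique (unweightedMK_isOptimalValue hqn), unweightedMK_mem_sosBounds_iff] at hv'
  obtain ⟨s₀, s₁, h₀, h₁, hd₀, hd₁, h⟩ := hv'
  generalize ⌈q⌉₊ = k at *
  have hz : ∀ T : Finset (Fin n), T.card = k → MvPolynomial.eval (cubePoint T) s₀ = 0 ∧
      MvPolynomial.eval (cubePoint T) s₁ = 0 := by
    intro T hT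
    have hT' := h T
    have hs₀ := MvPolynomial.eval_nonneg_of_isSumSq h₀ (cubePoint T)
    have hs₁ := MvPolynomial.eval_nonneg_of_isSumSq h₁ (cubePoint T)
    rw [hT, sub_self] at hT'
    have hm := mul_nonneg hs₁ (sub_nonneg.2 hq.le)
    exact ⟨by linarith, (mul_eq_zero.1 (by linarith)).resolve_right (sub_pos.2 hq).ne'⟩
  obtain ⟨R₀, hR₀, hs₀⟩ := exists_eq_sq_mul_of_isSumSq hdk hkn h₀ (by omega) fun T hT => (hz T hT).1
  obtain ⟨R₁, hR₁, hs₁⟩ := exists_eq_sq_mul_of_isSumSq hdk hkn h₁ (by omega) fun T hT => (hz T hT).2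
  obtain ⟨P₀, hP₀, hsum₀⟩ := exists_polynomial_sum_level hR₀
  obtain ⟨P₁, hP₁, hsum₁⟩ := exists_polynomial_sum_level hR₁
  -- Both sides have degree at most 2 + 2(d + 1) + 1 = 2d + 5 < n + 1, the number of levels.
  have hpoly : (Polynomial.X - Polynomial.C (k : ℝ)) = (Polynomial.X - Polynomial.C (k : ℝ)) ^ 2 *
      (P₀ + P₁ * (Polynomial.X - Polynomial.C q)) := by
    refine Polynomial.eq_of_natDegree_lt_card_of_eval_eq _ _
      (f := fun j : Fin (n + 1) => ((j : ℕ) : ℝ)) ?_ ?_ ?_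
    · intro i j hij
      exact Fin.ext (Nat.cast_injective (R := ℝ) hij)
    · intro j
      have hj : (j : ℕ) ≤ Fintype.card (Fin n) := by
        rw [Fintype.card_fin]
        exact Nat.lt_succ_iff.1 j.2
      have hpos : ((Fintype.card (Fin n)).choose j : ℝ) ≠ 0 := by
        exact_mod_cast (Nat.choose_pos hj).ne'
      have hsum : ∑ T ∈ (Finset.univ : Finset (Fin n)).powersetCard j, (((j : ℕ) : ℝ) - k)
          = ∑ T ∈ (Finset.univ : Finset (Fin n)).powersetCard j,
            ((((j : ℕ) : ℝ) - k) ^ 2 * R₀ T + (((j : ℕ) : ℝ) - k) ^ 2 * (j - q) * R₁ T) := by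
        refine Finset.sum_congr rfl fun T hT => ?_
        have hT' := h T
        rw [hs₀, hs₁, (Finset.mem_powersetCard.1 hT).2] at hT'
        linear_combination hT'
      rw [Finset.sum_const, Finset.card_powersetCard, Finset.card_univ, nsmul_eq_mul,
        Finset.sum_add_distrib, ← Finset.mul_sum, ← Finset.mul_sum, hsum₀ j hj, hsum₁ j hj] at hsum
      apply mul_left_cancel₀ hpos
      simp only [Polynomial.eval_mul, Polynomial.eval_sub, Polynomial.eval_X, Polynomial.eval_C,
        Polynomial.eval_pow, Polynomial.eval_add]
      rw [hsum]
      ring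
    · rw [Fintype.card_fin]
      have hl : ∀ c : ℝ, (Polynomial.X - Polynomial.C c).natDegree ≤ 1 :=
        fun c => (Polynomial.natDegree_X_sub_C c).le
      have h1 : (P₀ + P₁ * (Polynomial.X - Polynomial.C q)).natDegree ≤ 2 * (d + 1) + 1 :=
        Polynomial.natDegree_add_le_of_degree_le (hP₀.trans (by omega))
          (Polynomial.natDegree_mul_le_of_le hP₁ (hl q))
      have h2 := Polynomial.natDegree_mul_le_of_le
        (Polynomial.natDegree_pow_le_of_le 2 (hl (k : ℝ))) h1
      have := hl (k : ℝ)
      omega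
  -- Differentiating at k gives 1 = 0.
  have hder := congrArg (fun p => (Polynomial.derivative p).eval (k : ℝ)) hpoly
  simp [Polynomial.derivative_mul, Polynomial.derivative_pow] at hder

theorem unweightedMK_sosRank_le (hqn : q ≤ n) : (unweightedMK n q).sosRank ≤ n :=
  Nat.sInf_le (unweightedMK_sosExact hqn)

/-- A linear lower bound for the sum-of-squares rank. -/
theorem le_unweightedMK_sosRank {a : ℝ} (ha₀ : 2 * a ≤ n) (ha₁ : a ≤ q) (ha₂ : a ≤ n - q)
    (hqn : q ≤ n) (hq : Int.fract q ≠ 0) : a - 3 ≤ (unweightedMK n q).sosRank := by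
  by_contra! hlt
  -- The set of exact degrees contains n, so its infimum is attained and is not the default value 0
  -- of an empty `sInf`.
  have hex : (unweightedMK n q).SOSExact (unweightedMK n q).sosRank :=
    Nat.sInf_mem (s := {d | (unweightedMK n q).SOSExact d}) ⟨n, unweightedMK_sosExact hqn⟩
  generalize (unweightedMK n q).sosRank = d at *
  have hd : (0 : ℝ) ≤ d := d.cast_nonneg
  have hk := Nat.le_ceil q
  have hk' := Nat.ceil_lt_add_one (show 0 ≤ q by linarith)
  have hqk : q < ⌈q⌉₊ := by
    refine lt_of_le_of_ne hk fun he => hq ?_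
    rw [he, Int.fract_natCast]
  -- The loss of 3 absorbs ⌈q⌉ < q + 1 and the offset in 2d + 5 ≤ n.
  refine unweightedMK_not_sosExact hqn hqk (d := d) ?_ ?_ ?_ hex
  · exact_mod_cast (show (d : ℝ) + 1 ≤ ⌈q⌉₊ by linarith)
  · exact_mod_cast (show (⌈q⌉₊ : ℝ) + (d + 1) ≤ n by linarith)
  · exact_mod_cast (show 2 * (d : ℝ) + 5 ≤ n by linarith)

end UnweightedKnapsack

theorem mainTheorem6 (q : ℕ → ℝ)
    (hq_range : ∀ᶠ n : ℕ in atTop, 0 < q n ∧ q n < n)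
    (hq_nonint : ∀ᶠ n : ℕ in atTop, Int.fract (q n) ≠ 0)
    (hq : q =Θ[atTop] (fun n : ℕ => (n : ℝ)))
    (hnq : (fun n : ℕ => (n : ℝ) - q n) =Θ[atTop] (fun n : ℕ => (n : ℝ))) :
    (fun n : ℕ => ((unweightedMK n (q n)).sosRank : ℝ)) =Θ[atTop] (fun n : ℕ => (n : ℝ)) := by
  constructor
  · refine IsBigO.of_bound 1 ?_
    filter_upwards [hq_range] with n hn
    simpa using unweightedMK_sosRank_le hn.2.le
  · obtain ⟨c₁, hc₁, h₁⟩ := hq.2.exists_pos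
    obtain ⟨c₂, hc₂, h₂⟩ := hnq.2.exists_pos
    -- With a = n/c, the 2 ensures 2a ≤ n. Then n ≤ c · rank + 3c, and n ≥ 6c absorbs 3c into n/2,
    -- whence the factor 2c.
    let c := max 2 (max c₁ c₂)
    have hc2 : 2 ≤ c := le_max_left _ _
    have hcc₁ : c₁ ≤ c := (le_max_left _ _).trans (le_max_right _ _)
    have hcc₂ : c₂ ≤ c := (le_max_right _ _).trans (le_max_right _ _)
    refine IsBigO.of_bound (2 * c) ?_
    filter_upwards [hq_range, hq_nonint, h₁.bound, h₂.bound,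
      tendsto_natCast_atTop_atTop.eventually_ge_atTop (6 * c)] with n hn hni hb₁ hb₂ hnc
    have hq0 : 0 ≤ q n := hn.1.le
    have hnq0 : 0 ≤ n - q n := by linarith [hn.2]
    rw [Real.norm_of_nonneg n.cast_nonneg, Real.norm_of_nonneg hq0] at hb₁
    rw [Real.norm_of_nonneg n.cast_nonneg, Real.norm_of_nonneg hnq0] at hb₂
    rw [Real.norm_of_nonneg n.cast_nonneg, Real.norm_of_nonneg (Nat.cast_nonneg _)]
    have hc : 0 < c := by linarith
    have key := le_unweightedMK_sosRank (n := n) (q := q n) (a := n / c) (by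
        rw [mul_div_assoc', div_le_iff₀ hc, mul_comm]
        exact mul_le_mul_of_nonneg_left hc2 n.cast_nonneg)
      (by
        rw [div_le_iff₀' hc]
        exact hb₁.trans (mul_le_mul_of_nonneg_right hcc₁ hq0))
      (by
        rw [div_le_iff₀' hc]
        exact hb₂.trans (mul_le_mul_of_nonneg_right hcc₂ hnq0))
      hn.2.le hni
    have hmul : (n : ℝ) / c * c = n := div_mul_cancel₀ _ hc.ne'
    have := mul_le_mul_of_nonneg_right key hc.le
    rw [sub_mul, hmul] at this
    linarith
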